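/- Let $L$ be a frame and let $\mathcal{R}L$ be the ring of continuous real-valued functions on $L$, that is, of frame homomorphisms $\mathfrak{O}\mathbb{R}\to L$, where for $\diamond\in\{+,\cdot\}$ one puts $(\alpha\diamond\beta)(W)=\bigvee\{\alpha(U)\wedge\beta(V) : U,V\subseteq\mathbb{R}\text{ open},\ x\diamond y\in W\text{ for all }x\in U,\ y\in V\}$. For $r\in\mathbb{R}$ let $\mathbf{r}\in\mathcal{R}L$ be the constant function ($\mathbf{r}(U)=1$ if $r\in U$ and $\mathbf{r}(U)=0$ otherwise), let $\operatorname{coz}\alpha=\alpha(-\infty,0)\vee\alpha(0,\infty)$, and let $R_\alpha=\{r\in\mathbb{R} : \operatorname{coz}(\alpha-\mathbf{r})\neq 1\}$. Put $\mathcal{R}_cL=\{\alpha\in\mathcal{R}L : R_\alpha\text{ is countable}\}$. A maximal ideal of a commutative ring is called real if its residue field is isomorphic to $\mathbb{R}$. Suppose that $L$ is completely regular and that $\mathcal{R}_cL$ is a subring of $\mathcal{R}L$. Then: 1. every maximal ideal of $\mathcal{R}_cL$ is of the form $M\cap\mathcal{R}_cL$ for some maximal ideal $M$ of $\mathcal{R}L$;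 2. if $M$ is a real maximal ideal of $\mathcal{R}L$, then $M\cap\mathcal{R}_cL$ is a real maximal ideal of $\mathcal{R}_cL$. -/

import Mathlib

open TopologicalSpace

namespace PointfreeReal

universe u v w

section Frames

variable {L : Type u} [Order.Frame L]

/-- `a` is rather below `b`: `a* ∨ b = 1`, with `a*` the pseudocomplement of `a`. -/
def RatherBelow (a b : L) : Prop := aᶜ ⊔ b = ⊤

/-- `a` is completely below `b`: there is a family indexed by the rationals of `[0,1]` that starts
at `a`, ends at `b` and increases strictly for the rather-below relation. -/
def CompletelyBelow (a b : L) : Prop :=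
  ∃ c : Set.Icc (0 : ℚ) 1 → L,
    c ⟨0, by norm_num⟩ = a ∧ c ⟨1, by norm_num⟩ = b ∧ ∀ p q, p < q → RatherBelow (c p) (c q)

/-- Complete regularity of a frame. -/
def IsCompletelyRegular (L : Type u) [Order.Frame L] : Prop :=
  ∀ a : L, IsLUB {x : L | CompletelyBelow x a} a

end Frames

section Pairing

variable {L : Type u} [Order.Frame L]

variable {X : Type v} {Y : Type w} [TopologicalSpace X] [TopologicalSpace Y]

/-- The value of the copairing of `α` and `β` at an open `W` of `X × Y`: the join of all
`α U ∧ β V` with `U × V ⊆ W`. -/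
def pairFun (α : FrameHom (Opens X) L) (β : FrameHom (Opens Y) L) (W : Opens (X × Y)) : L :=
  ⨆ p : {p : Opens X × Opens Y // (p.1 : Set X) ×ˢ (p.2 : Set Y) ⊆ (W : Set (X × Y))},
    α p.1.1 ⊓ β p.1.2

theorem le_pairFun (α : FrameHom (Opens X) L) (β : FrameHom (Opens Y) L) {W : Opens (X × Y)}
    (U : Opens X) (V : Opens Y) (h : (U : Set X) ×ˢ (V : Set Y) ⊆ (W : Set (X × Y))) :
    α U ⊓ β V ≤ pairFun α β W :=
  le_iSup (fun p : {p : Opens X × Opens Y //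
    (p.1 : Set X) ×ˢ (p.2 : Set Y) ⊆ (W : Set (X × Y))} => α p.1.1 ⊓ β p.1.2) ⟨(U, V), h⟩

theorem pairFun_mono (α : FrameHom (Opens X) L) (β : FrameHom (Opens Y) L)
    {W W' : Opens (X × Y)} (h : W ≤ W') : pairFun α β W ≤ pairFun α β W' :=
  iSup_le fun p => le_pairFun α β p.1.1 p.1.2 (p.2.trans h)

theorem le_of_isCompact (α : FrameHom (Opens X) L) (β : FrameHom (Opens Y) L)
    (S : Set (Opens (X × Y))) (U : Opens X) (K : Set X) (hK : IsCompact K)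
    (hUK : (U : Set X) ⊆ K) (V : Opens Y)
    (hKV : K ×ˢ (V : Set Y) ⊆ ((sSup S : Opens (X × Y)) : Set (X × Y))) :
    α U ⊓ β V ≤ ⨆ W ∈ S, pairFun α β W := by
  -- the statement at a single point of `V`
  have key : ∀ y ∈ V, ∃ V' : Opens Y, y ∈ V' ∧ α U ⊓ β V' ≤ ⨆ W ∈ S, pairFun α β W := by
    intro y hy
    have h1 : ∀ x : K, ∃ (A : Opens X) (B : Opens Y), x.1 ∈ A ∧ y ∈ B ∧
        α A ⊓ β B ≤ ⨆ W ∈ S, pairFun α β W := by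
      intro x
      have hx : (x.1, y) ∈ (sSup S : Opens (X × Y)) := hKV ⟨x.2, hy⟩
      obtain ⟨W, hW, hxW⟩ := Opens.mem_sSup.1 hx
      obtain ⟨a, b, ha, hb, hxa, hyb, hab⟩ := isOpen_prod_iff.1 W.2 x.1 y hxW
      exact ⟨⟨a, ha⟩, ⟨b, hb⟩, hxa, hyb,
        (le_pairFun α β (W := W) ⟨a, ha⟩ ⟨b, hb⟩ hab).trans
          (le_iSup₂ (f := fun W (_ : W ∈ S) => pairFun α β W) W hW)⟩
    choose A B hA hB hAB using h1
    obtain ⟨t, ht⟩ := hK.elim_finite_subcover (fun x : K => (A x : Set X)) (fun x => (A x).2)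
      (fun x hx => Set.mem_iUnion.2 ⟨⟨x, hx⟩, hA ⟨x, hx⟩⟩)
    refine ⟨t.inf B, ?_, ?_⟩
    · have : ∀ s : Finset K, y ∈ s.inf B := by
        classical
        intro s
        induction s using Finset.induction_on with
        | empty => simp
        | insert a s _ ih => rw [Finset.inf_insert]; exact ⟨hB a, ih⟩
      exact this t
    · have h2 : U ≤ ⨆ x : t, A x.1 := by
        intro x hx
        obtain ⟨z, hz, hxz⟩ := Set.mem_iUnion₂.1 (ht (hUK hx))
        exact Opens.mem_iSup.2 ⟨⟨z, hz⟩, hxz⟩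
      calc α U ⊓ β (t.inf B) ≤ α (⨆ x : t, A x.1) ⊓ β (t.inf B) :=
            inf_le_inf_right _ (OrderHomClass.mono α h2)
        _ = ⨆ x : t, α (A x.1) ⊓ β (t.inf B) := by rw [map_iSup, iSup_inf_eq]
        _ ≤ _ := iSup_le fun x =>
            (inf_le_inf_left _ (OrderHomClass.mono β (Finset.inf_le x.2))).trans (hAB x.1)
  choose! V' hV' hle using key
  have h3 : V ≤ ⨆ y : V, V' y.1 := fun y hy => Opens.mem_iSup.2 ⟨⟨y, hy⟩, hV' y hy⟩
  calc α U ⊓ β V ≤ α U ⊓ β (⨆ y : V, V' y.1) := inf_le_inf_left _ (OrderHomClass.mono β h3)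
    _ = ⨆ y : V, α U ⊓ β (V' y.1) := by rw [map_iSup, inf_iSup_eq]
    _ ≤ _ := iSup_le fun y => hle y.1 y.2

/-- The copairing `𝔒(X × Y) → L` of two frame maps `𝔒X → L` and `𝔒Y → L`, for locally compact
`X` (where `𝔒(X × Y)` is the coproduct of the frames `𝔒X` and `𝔒Y`). -/
def pair [LocallyCompactSpace X] (α : FrameHom (Opens X) L) (β : FrameHom (Opens Y) L) :
    FrameHom (Opens (X × Y)) L where
  toFun := pairFun α β
  map_inf' W W' := by
    refine le_antisymm (le_inf (pairFun_mono α β inf_le_left) (pairFun_mono α β inf_le_right)) ?_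
    unfold pairFun
    rw [iSup_inf_iSup]
    refine iSup_le fun p => ?_
    have : α p.1.1.1 ⊓ β p.1.1.2 ⊓ (α p.2.1.1 ⊓ β p.2.1.2)
        = α (p.1.1.1 ⊓ p.2.1.1) ⊓ β (p.1.1.2 ⊓ p.2.1.2) := by
      rw [map_inf, map_inf, inf_inf_inf_comm]
    rw [this]
    refine le_pairFun α β _ _ ?_
    rintro ⟨x, y⟩ ⟨hx, hy⟩
    exact ⟨p.1.2 ⟨hx.1, hy.1⟩, p.2.2 ⟨hx.2, hy.2⟩⟩
  map_top' := by
    refine top_le_iff.1 ?_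
    have := le_pairFun α β (W := ⊤) ⊤ ⊤ (fun _ _ => trivial)
    simpa using this
  map_sSup' S := by
    rw [sSup_image]
    refine le_antisymm (iSup_le ?_) (iSup₂_le fun W hW => pairFun_mono α β (le_sSup hW))
    rintro ⟨⟨U, V⟩, h⟩
    have hU : U ≤ ⨆ x : U, ⨆ K : {K : Set X // IsCompact K ∧ K ⊆ (U : Set X)},
        (⟨interior K.1, isOpen_interior⟩ : Opens X) := by
      intro x hx
      obtain ⟨K, hK, hxK, hKU⟩ := exists_compact_subset U.2 hx
      exact Opens.mem_iSup.2 ⟨⟨x, hx⟩, Opens.mem_iSup.2 ⟨⟨K, hK, hKU⟩, hxK⟩⟩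
    refine (inf_le_inf_right _ (OrderHomClass.mono α hU)).trans ?_
    simp only [map_iSup, iSup_inf_eq]
    exact iSup_le fun x => iSup_le fun K => le_of_isCompact α β S _ K.1 K.2.1 interior_subset V
      ((Set.prod_mono K.2.2 subset_rfl).trans h)

end Pairing

section Functoriality

variable {L : Type u} [Order.Frame L]

variable {X : Type v} {Y : Type w} [TopologicalSpace X] [TopologicalSpace Y]

/-- Composition of a "generalized point" `d : 𝔒X → L` with a continuous map `f : X → Y`. -/
def push (f : C(X, Y)) (d : FrameHom (Opens X) L) : FrameHom (Opens Y) L := d.comp (Opens.comap f)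

theorem push_apply (f : C(X, Y)) (d : FrameHom (Opens X) L) (U : Opens Y) :
    push f d U = d (Opens.comap f U) := rfl

theorem pair_push {Z : Type*} [TopologicalSpace Z] [LocallyCompactSpace X]
    (f : C(Z, X)) (g : C(Z, Y)) (d : FrameHom (Opens Z) L) :
    pair (push f d) (push g d) = push (f.prodMk g) d := by
  ext W
  change pairFun _ _ W = d (Opens.comap _ W)
  apply le_antisymm
  · refine iSup_le fun p => ?_
    rw [push_apply, push_apply, ← map_inf]
    refine OrderHomClass.mono d ?_
    intro z hz
    exact p.2 ⟨hz.1, hz.2⟩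
  · have h : Opens.comap (f.prodMk g) W ≤
        ⨆ p : {p : Opens X × Opens Y // (p.1 : Set X) ×ˢ (p.2 : Set Y) ⊆ (W : Set (X × Y))},
          Opens.comap f p.1.1 ⊓ Opens.comap g p.1.2 := by
      intro z hz
      obtain ⟨a, b, ha, hb, hxa, hyb, hab⟩ := isOpen_prod_iff.1 W.2 (f z) (g z) hz
      exact Opens.mem_iSup.2 ⟨⟨(⟨a, ha⟩, ⟨b, hb⟩), hab⟩, ⟨hxa, hyb⟩⟩
    refine (OrderHomClass.mono d h).trans ?_
    rw [map_iSup]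
    refine iSup_mono fun p => ?_
    rw [map_inf]
    rfl

theorem push_fst_pair [LocallyCompactSpace X] (α : FrameHom (Opens X) L)
    (β : FrameHom (Opens Y) L) : push ContinuousMap.fst (pair α β) = α := by
  ext U
  change pairFun α β _ = α U
  apply le_antisymm
  · refine iSup_le fun p => ?_
    by_cases hV : p.1.2 = ⊥
    · simp [hV]
    · obtain ⟨y, hy⟩ := (Opens.ne_bot_iff_nonempty _).1 hV
      exact inf_le_left.trans (OrderHomClass.mono α fun x hx =>
        p.2 (show (x, y) ∈ (p.1.1 : Set X) ×ˢ (p.1.2 : Set Y) from ⟨hx, hy⟩))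
  · have := le_pairFun α β (W := Opens.comap ContinuousMap.fst U) U ⊤ (fun z hz => hz.1)
    simpa using this

theorem push_snd_pair [LocallyCompactSpace X] (α : FrameHom (Opens X) L)
    (β : FrameHom (Opens Y) L) : push ContinuousMap.snd (pair α β) = β := by
  ext V
  change pairFun α β _ = β V
  apply le_antisymm
  · refine iSup_le fun p => ?_
    by_cases hU : p.1.1 = ⊥
    · simp [hU]
    · obtain ⟨x, hx⟩ := (Opens.ne_bot_iff_nonempty _).1 hU
      exact inf_le_right.trans (OrderHomClass.mono β fun y hy =>
        p.2 (show (x, y) ∈ (p.1.1 : Set X) ×ˢ (p.1.2 : Set Y) from ⟨hx, hy⟩))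
  · have := le_pairFun α β (W := Opens.comap ContinuousMap.snd V) ⊤ V (fun z hz => hz.2)
    simpa using this

end Functoriality

section RealFunctions

/-- The set `ℛL` of continuous real-valued functions on the frame `L`: the frame maps from the
frame of reals, realized as the frame of open subsets of `ℝ`, to `L`. -/
abbrev RealFun (L : Type u) [Order.Frame L] : Type u := FrameHom (Opens ℝ) L

variable {L : Type u} [Order.Frame L]

/-- The constant function `𝐫`: it sends `U` to `1` if `r ∈ U` and to `0` otherwise. -/
def const (r : ℝ) : RealFun L where
  toFun U := ⨆ _ : r ∈ U, ⊤
  map_inf' U V := by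
    by_cases h : r ∈ U <;> by_cases h' : r ∈ V <;> simp [h, h', Opens.mem_inf]
  map_top' := by simp
  map_sSup' S := by
    rw [sSup_image]
    apply le_antisymm
    · refine iSup_le fun h => ?_
      obtain ⟨U, hU, hr⟩ := Opens.mem_sSup.1 h
      exact le_iSup₂_of_le U hU (le_iSup_of_le hr le_rfl)
    · refine iSup₂_le fun U hU => iSup_le fun hr => ?_
      exact le_iSup_of_le (Opens.mem_sSup.2 ⟨U, hU, hr⟩) le_rfl

/-- `(α + β)(W) = ⋁ {α(U) ∧ β(V) ∣ U + V ⊆ W}`. -/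
instance : Add (RealFun L) := ⟨fun α β => push ⟨fun p : ℝ × ℝ => p.1 + p.2, by fun_prop⟩ (pair α β)⟩

/-- `(α β)(W) = ⋁ {α(U) ∧ β(V) ∣ U V ⊆ W}`. -/
instance : Mul (RealFun L) := ⟨fun α β => push ⟨fun p : ℝ × ℝ => p.1 * p.2, by fun_prop⟩ (pair α β)⟩

/-- `(-α)(W) = α(-W)`. -/
instance : Neg (RealFun L) := ⟨fun α => push ⟨fun x : ℝ => -x, by fun_prop⟩ α⟩

instance : Zero (RealFun L) := ⟨const 0⟩

instance : One (RealFun L) := ⟨const 1⟩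

variable {X : Type v} [TopologicalSpace X]

theorem push_add (f g : C(X, ℝ)) (d : FrameHom (Opens X) L) :
    push f d + push g d = push (f + g) d := by
  change push _ (pair _ _) = _
  rw [pair_push]; rfl

theorem push_mul (f g : C(X, ℝ)) (d : FrameHom (Opens X) L) :
    push f d * push g d = push (f * g) d := by
  change push _ (pair _ _) = _
  rw [pair_push]; rfl

theorem push_neg' (f : C(X, ℝ)) (d : FrameHom (Opens X) L) : -push f d = push (-f) d := rfl

theorem push_const (r : ℝ) (d : FrameHom (Opens X) L) :
    push (ContinuousMap.const X r) d = const r := by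
  ext U
  rw [push_apply]
  change _ = ⨆ _ : r ∈ U, (⊤ : L)
  by_cases h : r ∈ U
  · have : Opens.comap (ContinuousMap.const X r) U = ⊤ := by
      ext x; simp [h]
    rw [this]; simp [h]
  · have : Opens.comap (ContinuousMap.const X r) U = ⊥ := by
      ext x; simp [h]
    rw [this]; simp [h]

theorem push_zero (d : FrameHom (Opens X) L) : (0 : RealFun L) = push (0 : C(X, ℝ)) d :=
  (push_const 0 d).symm

theorem push_one (d : FrameHom (Opens X) L) : (1 : RealFun L) = push (1 : C(X, ℝ)) d :=
  (push_const 1 d).symm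

theorem exists_push (α β γ : RealFun L) : ∃ (d : FrameHom (Opens (ℝ × ℝ × ℝ)) L)
    (f g h : C(ℝ × ℝ × ℝ, ℝ)), α = push f d ∧ β = push g d ∧ γ = push h d := by
  refine ⟨pair α (pair β γ), ContinuousMap.fst, ContinuousMap.fst.comp ContinuousMap.snd,
    ContinuousMap.snd.comp ContinuousMap.snd, (push_fst_pair _ _).symm, ?_, ?_⟩
  · change β = push ContinuousMap.fst (push ContinuousMap.snd (pair α (pair β γ)))
    rw [push_snd_pair, push_fst_pair]
  · change γ = push ContinuousMap.snd (push ContinuousMap.snd (pair α (pair β γ)))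
    rw [push_snd_pair, push_snd_pair]

/-- The ring `ℛL`. -/
instance : CommRing (RealFun L) where
  add_assoc α β γ := by
    obtain ⟨d, f, g, h, rfl, rfl, rfl⟩ := exists_push α β γ
    simp only [push_add, add_assoc]
  zero_add α := by
    obtain ⟨d, f, g, h, rfl, -, -⟩ := exists_push α α α
    rw [push_zero d, push_add, zero_add]
  add_zero α := by
    obtain ⟨d, f, g, h, rfl, -, -⟩ := exists_push α α α
    rw [push_zero d, push_add, add_zero]
  add_comm α β := by
    obtain ⟨d, f, g, h, rfl, rfl, -⟩ := exists_push α β β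
    simp only [push_add, add_comm]
  neg_add_cancel α := by
    obtain ⟨d, f, g, h, rfl, -, -⟩ := exists_push α α α
    rw [push_zero d, push_neg', push_add, neg_add_cancel]
  mul_assoc α β γ := by
    obtain ⟨d, f, g, h, rfl, rfl, rfl⟩ := exists_push α β γ
    simp only [push_mul, mul_assoc]
  mul_comm α β := by
    obtain ⟨d, f, g, h, rfl, rfl, -⟩ := exists_push α β β
    simp only [push_mul, mul_comm]
  one_mul α := by
    obtain ⟨d, f, g, h, rfl, -, -⟩ := exists_push α α α
    rw [push_one d, push_mul, one_mul]
  mul_one α := by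
    obtain ⟨d, f, g, h, rfl, -, -⟩ := exists_push α α α
    rw [push_one d, push_mul, mul_one]
  left_distrib α β γ := by
    obtain ⟨d, f, g, h, rfl, rfl, rfl⟩ := exists_push α β γ
    simp only [push_mul, push_add, mul_add]
  right_distrib α β γ := by
    obtain ⟨d, f, g, h, rfl, rfl, rfl⟩ := exists_push α β γ
    simp only [push_mul, push_add, add_mul]
  zero_mul α := by
    obtain ⟨d, f, g, h, rfl, -, -⟩ := exists_push α α α
    rw [push_zero d, push_mul, zero_mul]
  mul_zero α := by
    obtain ⟨d, f, g, h, rfl, -, -⟩ := exists_push α α α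
    rw [push_zero d, push_mul, mul_zero]
  nsmul := nsmulRec
  zsmul := zsmulRec

/-- The cozero element `coz α = α(-,0) ∨ α(0,-)`. -/
def coz (α : RealFun L) : L := α ⟨Set.Iio 0, isOpen_Iio⟩ ⊔ α ⟨Set.Ioi 0, isOpen_Ioi⟩

/-- The pointfree image `R_α = {r ∈ ℝ ∣ coz (α - 𝐫) ≠ 1}`. -/
def pointfreeImage (α : RealFun L) : Set ℝ := {r | coz (α - const r) ≠ ⊤}

end RealFunctions

/-- A real ideal of a commutative ring: a maximal ideal with residue field isomorphic to `ℝ`. -/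
def IsRealIdeal {A : Type u} [CommRing A] (I : Ideal A) : Prop :=
  I.IsMaximal ∧ Nonempty (A ⧸ I ≃+* ℝ)

end PointfreeReal

namespace PointfreeReal

universe u v

variable {L : Type u} [Order.Frame L] {X : Type v} [TopologicalSpace X]

/-! Finitely many elements of `ℛL` can be written as `push f d` for one generalized point `d`
(`exists_push`), so algebraic facts about cozero elements reduce to pointwise facts about zero sets
of real functions.

For contractions, the key is `exists_mul_eq_one_of_coz_eq_top`: cozero element `1` forces an
inverse, and inversion keeps a countable pointfree image countable. So an element of `ℛ_cL` with
cozero element `1` is a unit there, and a maximal `Q` generates a proper `cozIdeal Q`. Any maximal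
ideal above that contracts to a proper ideal containing `Q`, hence to `Q`.

For real ideals, the constants lie in `ℛ_cL` and already fill the residue field `ℝ`, since `ℝ` has
only the identity as ring endomorphism. -/

/-! ### Cozero elements -/

theorem push_sub_const (f : C(X, ℝ)) (d : FrameHom (Opens X) L) (r : ℝ) :
    push f d - const r = push (f - ContinuousMap.const X r) d := by
  rw [← push_const r d, sub_eq_add_neg, push_neg', push_add, ← sub_eq_add_neg]

/-- This turns comparisons of cozero elements into inclusions of ordinary cozero sets. -/
theorem coz_push (f : C(X, ℝ)) (d : FrameHom (Opens X) L) :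
    coz (push f d) = d ⟨{x | f x ≠ 0}, isOpen_ne_fun f.continuous continuous_const⟩ := by
  rw [coz, push_apply, push_apply, ← map_sup]
  congr 1
  ext x
  exact lt_or_lt_iff_ne (a := f x) (b := 0)

theorem coz_one : coz (1 : RealFun L) = ⊤ := by
  -- Constants are pushes along every generalized point; this `d` is an arbitrary choice.
  let d : FrameHom (Opens ℝ) L := const 0
  rw [push_one d, coz_push, ← map_top d]
  congr 1
  ext x
  simp

theorem coz_zero : coz (0 : RealFun L) = ⊥ := by
  let d : FrameHom (Opens ℝ) L := const 0
  rw [push_zero d, coz_push, ← map_bot d]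
  congr 1
  ext x
  simp

theorem coz_add_le (α β : RealFun L) : coz (α + β) ≤ coz α ⊔ coz β := by
  obtain ⟨d, f, g, -, rfl, rfl, -⟩ := exists_push α β β
  rw [push_add, coz_push, coz_push, coz_push, ← map_sup]
  refine OrderHomClass.mono d fun x hx => ?_
  by_contra h
  obtain ⟨h₁, h₂⟩ := not_or.1 h
  exact hx (by simp [not_not.1 h₁, not_not.1 h₂])

theorem coz_mul_le_right (α β : RealFun L) : coz (α * β) ≤ coz β := by
  obtain ⟨d, f, g, -, rfl, rfl, -⟩ := exists_push α β β
  rw [push_mul, coz_push, coz_push]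
  exact OrderHomClass.mono d fun x hx => right_ne_zero_of_mul hx

/-- A sum of two real squares vanishes only where both terms do. This lets one element of an ideal
dominate the cozero elements of two. -/
theorem coz_sup_coz_le (α β : RealFun L) : coz α ⊔ coz β ≤ coz (α * α + β * β) := by
  obtain ⟨d, f, g, -, rfl, rfl, -⟩ := exists_push α β β
  rw [push_mul, push_mul, push_add, coz_push, coz_push, coz_push, ← map_sup]
  refine OrderHomClass.mono d fun x hx hx' => ?_
  obtain ⟨h₁, h₂⟩ := mul_self_add_mul_self_eq_zero.1 hx'
  exact hx.elim (fun h => h h₁) (fun h => h h₂)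

/-! ### Inverting functions with cozero element `1` -/

/-- A frame map on the opens of `X` that sends an open subset `s` to `1` factors through the
subspace `s`. -/
def restrict (α : FrameHom (Opens X) L) (s : Opens X) (h : α s = ⊤) : FrameHom (Opens s) L where
  toFun V := α ⟨Subtype.val '' (V : Set s), s.2.isOpenMap_subtype_val _ V.2⟩
  map_inf' U V := by
    rw [← map_inf]
    congr 1
    ext x
    exact Set.ext_iff.1 (Set.image_inter Subtype.val_injective) x
  map_top' := by
    rw [← h]
    congr 1
    ext x
    simp
  map_sSup' S := by
    rw [← Set.image_image α, ← map_sSup]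
    congr 1
    ext x
    rw [SetLike.mem_coe, SetLike.mem_coe, Opens.mem_sSup]
    simp only [Set.exists_mem_image]
    constructor
    · rintro ⟨y, hy, rfl⟩
      obtain ⟨V, hV, hyV⟩ := Opens.mem_sSup.1 hy
      exact ⟨V, hV, y, hyV, rfl⟩
    · rintro ⟨V, hV, y, hyV, rfl⟩
      exact ⟨y, Opens.mem_sSup.2 ⟨V, hV, hyV⟩, rfl⟩

theorem push_restrict (α : FrameHom (Opens X) L) (s : Opens X) (h : α s = ⊤) :
    push ⟨Subtype.val, continuous_subtype_val⟩ (restrict α s h) = α := by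
  ext U
  have : α U = α (s ⊓ U) := by rw [map_inf, h, top_inf_eq]
  rw [this, push_apply]
  change α _ = _
  congr 1
  ext x
  constructor
  · rintro ⟨y, hy, rfl⟩
    exact ⟨y.2, hy⟩
  · rintro ⟨h₁, h₂⟩
    exact ⟨⟨x, h₁⟩, h₂, rfl⟩

/-- A real function with cozero element `1` has an inverse, whose pointfree image consists of
inverses of elements of the given pointfree image. -/
theorem exists_mul_eq_one_of_coz_eq_top (α : RealFun L) (h : coz α = ⊤) :
    ∃ β : RealFun L, α * β = 1 ∧ pointfreeImage β ⊆ (·⁻¹) ⁻¹' pointfreeImage α := by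
  let s : Opens ℝ := ⟨{x | x ≠ 0}, isOpen_ne⟩
  have hs : α s = ⊤ := by
    rw [← h, coz, ← map_sup]
    congr 1
    ext x
    exact lt_or_lt_iff_ne.symm
  -- Inversion is not continuous on `ℝ` but is on `s`, so `α` is first factored through `s`.
  obtain ⟨d, hd⟩ : ∃ d : FrameHom (Opens s) L,
      push ⟨Subtype.val, continuous_subtype_val⟩ d = α := ⟨_, push_restrict α s hs⟩
  let i : C(s, ℝ) := ⟨fun x => (x : ℝ)⁻¹, continuous_subtype_val.inv₀ fun x => x.2⟩
  refine ⟨push i d, ?_, fun r hr hα => hr ?_⟩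
  · rw [← hd, push_mul, push_one d]
    congr 1
    ext x
    exact mul_inv_cancel₀ x.2
  · rw [push_sub_const, coz_push, ← top_le_iff]
    rw [← hd, push_sub_const, coz_push] at hα
    rw [← hα]
    -- On `s`, `x⁻¹ = r` forces `x = r⁻¹`; the case `r = 0` needs no separate treatment.
    refine OrderHomClass.mono d fun x hx hx' => hx ?_
    have hx'' : (x : ℝ)⁻¹ = r := sub_eq_zero.1 hx'
    change (x : ℝ) - r⁻¹ = 0
    rw [← hx'', inv_inv, sub_self]

/-! ### Constant functions -/

/-- The constant functions, as a ring homomorphism. -/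
def constHom (L : Type u) [Order.Frame L] : ℝ →+* RealFun L where
  toFun := const
  map_zero' := rfl
  map_one' := rfl
  map_add' r s := by
    let d : FrameHom (Opens ℝ) L := const 0
    rw [← push_const r d, ← push_const s d, ← push_const (r + s) d, push_add]
    rfl
  map_mul' r s := by
    let d : FrameHom (Opens ℝ) L := const 0
    rw [← push_const r d, ← push_const s d, ← push_const (r * s) d, push_mul]
    rfl

/-- A nonzero constant difference has cozero element `1`. Only an inclusion holds in general: over
the trivial frame the image is empty. -/
theorem pointfreeImage_const_subset (r : ℝ) : pointfreeImage (const r : RealFun L) ⊆ {r} := by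
  intro s hs
  by_contra hne
  refine hs ?_
  let d : FrameHom (Opens ℝ) L := const 0
  rw [← push_const r d, push_sub_const, coz_push, ← map_top d]
  congr 1
  ext x
  simpa [sub_eq_zero] using Ne.symm hne

/-! ### Maximal and real ideals -/

/-- The ideal of `ℛL` of all functions whose cozero element lies below that of a member of an
ideal `Q` of a subring. -/
def cozIdeal {A : Subring (RealFun L)} (Q : Ideal A) : Ideal (RealFun L) where
  carrier := {α | ∃ q ∈ Q, coz α ≤ coz (q : RealFun L)}
  zero_mem' := ⟨0, Q.zero_mem, by rw [coz_zero]; exact bot_le⟩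
  add_mem' := by
    rintro α β ⟨p, hp, hαp⟩ ⟨q, hq, hβq⟩
    exact ⟨p * p + q * q, Q.add_mem (Q.mul_mem_left _ hp) (Q.mul_mem_left _ hq),
      (coz_add_le α β).trans ((sup_le_sup hαp hβq).trans (coz_sup_coz_le _ _))⟩
  smul_mem' := by
    rintro α β ⟨q, hq, hβq⟩
    exact ⟨q, hq, (coz_mul_le_right α β).trans hβq⟩

/-- The hypothesis `hA` puts the inverse of an element of `A` with cozero element `1` back into `A`.
So if `cozIdeal Q` contained `1`, then `Q` would contain a unit. -/
theorem exists_isMaximal_eq_comap {A : Subring (RealFun L)}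
    (hA : ∀ α ∈ A, ∀ β : RealFun L, pointfreeImage β ⊆ (·⁻¹) ⁻¹' pointfreeImage α → β ∈ A)
    (Q : Ideal A) (hQ : Q.IsMaximal) :
    ∃ M : Ideal (RealFun L), M.IsMaximal ∧ Q = M.comap A.subtype := by
  have hne : cozIdeal Q ≠ ⊤ := by
    intro htop
    obtain ⟨q, hq, hle⟩ := (Ideal.eq_top_iff_one _).1 htop
    rw [coz_one, top_le_iff] at hle
    obtain ⟨β, hβ, himage⟩ := exists_mul_eq_one_of_coz_eq_top _ hle
    exact hQ.ne_top (Ideal.eq_top_of_isUnit_mem _ hq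
      (.of_mul_eq_one ⟨β, hA _ q.2 β himage⟩ (Subtype.ext hβ)))
  obtain ⟨M, hM, hle⟩ := Ideal.exists_le_maximal _ hne
  exact ⟨M, hM, hQ.eq_of_le (Ideal.comap_ne_top _ hM.ne_top) fun q hq => hle ⟨q, hq, le_rfl⟩⟩

/-- Real ideals contract to real ideals along a ring homomorphism through which `ℝ` maps. -/
theorem IsRealIdeal.comap {A B : Type*} [CommRing A] [CommRing B] {M : Ideal B}
    (hM : IsRealIdeal M) (φ : A →+* B) (c : ℝ →+* A) : IsRealIdeal (M.comap φ) := by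
  obtain ⟨-, ⟨e⟩⟩ := hM
  let ψ : A →+* ℝ := e.toRingHom.comp ((Ideal.Quotient.mk M).comp φ)
  have hψ : Function.Surjective ψ := fun r =>
    -- `ψ.comp c` is a ring endomorphism of `ℝ`, hence the identity, so `c r` is a preimage of `r`.
    ⟨c r, RingHom.congr_fun (Subsingleton.elim (ψ.comp c) (RingHom.id ℝ)) r⟩
  have hker : RingHom.ker ψ = M.comap φ := by
    ext a
    simp [ψ, RingHom.mem_ker, Ideal.Quotient.eq_zero_iff_mem]
  rw [← hker]
  exact ⟨RingHom.ker_isMaximal_of_surjective ψ hψ,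
    ⟨RingHom.quotientKerEquivOfSurjective hψ⟩⟩

end PointfreeReal

open PointfreeReal in
/-- `Rc` is the ring `ℛ_cL` of all elements of `ℛL` whose pointfree image is countable; for an ideal
`M` of `ℛL`, `M.comap Rc.subtype` is the contraction `M ∩ ℛ_cL`. -/
theorem corollary3p7 {L : Type*} [Order.Frame L] (hL : IsCompletelyRegular L)
    (Rc : Subring (RealFun L))
    (hRc : ∀ α : RealFun L, α ∈ Rc ↔ (pointfreeImage α).Countable) :
    (∀ Q : Ideal Rc, Q.IsMaximal →
      ∃ M : Ideal (RealFun L), M.IsMaximal ∧ Q = M.comap Rc.subtype) ∧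
    (∀ M : Ideal (RealFun L), IsRealIdeal M → IsRealIdeal (M.comap Rc.subtype)) := by
  refine ⟨exists_isMaximal_eq_comap fun α hα β hβ => ?_, fun M hM => ?_⟩
  · exact (hRc β).2 ((((hRc α).1 hα).preimage inv_injective).mono hβ)
  · exact hM.comap _ ((constHom _).codRestrict Rc fun r =>
      (hRc _).2 ((Set.countable_singleton r).mono (pointfreeImage_const_subset r)))
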